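/- Let $c$ be the Euler–Mascheroni constant and let $\mu$ be the (centred) Gumbel measure on $\mathbb{R}$, with density $g(y)=\exp\bigl(-(y+c+e^{-(y+c)})\bigr)$, i.e. with distribution function $\exp(-e^{-(y+c)})$. Let $\mu^m$ be its $m$-fold product on $\mathbb{R}^m$. Let $F:\mathbb{R}^m\to\mathbb{R}$ be a continuous function which is absolutely continuous on every compact segment of almost every line parallel to a coordinate axis (this holds for instance if $F$ is locally Lipschitz). Suppose that $\mu^m$-almost everywhere $F$ is differentiable with $\|\nabla F\|_2^2\le a^2$ and $\|\nabla F\|_\infty\le b$, and that for every $i$ and all fixed values of the other coordinates $$\lim_{y_i\to\pm\infty}F(y_1,\dots,y_m)\prod_{k=1}^m g(y_k)=0 .$$ Let $M\ge 1$, let $\delta\in(0,1)$, and let $\eta_1,\dots,\eta_M$ be i.i.d. real random variables, each with the distribution of $F$ under $\mu^m$. Then $F$ is $\mu^m$-integrable and, writing $\mathbb{E}[F]=\int F\,d\mu^m$, with probability at least $1-\delta$, $$\frac1M\sum_{j=1}^M\eta_j-\mathbb{E}[F]\le\max\left(\frac{20b}{M}\log\frac1\delta,\ \sqrt{\frac{20a^2}{M}\log\frac1\delta}\right).$$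 -/

import Mathlib

open MeasureTheory ProbabilityTheory Filter Topology

noncomputable section

/-- The density `g(y) = exp(-((y + c) + exp(-(y + c))))` of the centred Gumbel distribution,
where `c` is the Euler-Mascheroni constant; its CDF is `exp(-exp(-(y + c)))`. -/
def gumbelPDF (y : ℝ) : ℝ :=
  Real.exp (-((y + Real.eulerMascheroniConstant) +
    Real.exp (-(y + Real.eulerMascheroniConstant))))

/-- The centred Gumbel distribution on the real line. -/
def gumbelMeasure : Measure ℝ :=
  volume.withDensity (fun y => ENNReal.ofReal (gumbelPDF y))

/-- The law of a vector of `m` i.i.d. centred Gumbel random variables. -/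
def gumbelProduct (m : ℕ) : Measure (Fin m → ℝ) :=
  Measure.pi (fun _ => gumbelMeasure)

/-- The `i`-th partial derivative of `F` at `y`, that is, the `i`-th entry of the gradient at a
point of differentiability. -/
def partialDeriv {m : ℕ} (F : (Fin m → ℝ) → ℝ) (i : Fin m) (y : Fin m → ℝ) : ℝ :=
  fderiv ℝ F y (Pi.single i 1)

/-- `F` is absolutely continuous on every compact segment of almost every line parallel to a
coordinate axis. -/
def ACOnCoordinateLines {m : ℕ} (F : (Fin m → ℝ) → ℝ) : Prop :=
  ∀ i : Fin m, ∀ᵐ y : Fin m → ℝ, ∀ s t : ℝ,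
    AbsolutelyContinuousOnInterval (fun x : ℝ => F (Function.update y i x)) s t

end

/-! ### The Gumbel density -/

/-! The engine is a transport inequality in dual form (Maurey's property (τ)): if `u x * v y ≤ ∏ i,
expCost (x i - y i)`, then the integrals of `u` and `v` against the Gumbel product have product at
most 1.

In dimension one this is a Prékopa–Leindler argument (`integral_mul_integral_le_one_of_continuous`).
A monotone map `T` carries the normalised density `u g` to `v g`, and one changes variables to the
skewed midpoint of `x` and `T x`, where the Gumbel density gains enough to pay for the cost
(`gumbelPDF_mul_le`). Integrating out one coordinate at a time gives every dimension.

The logarithm of `expCost` dominates `h ^ 2 / 20` for `|h| ≤ 2` and `|h| / 10` beyond. The gradient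
bounds make the increments of `F` at most `a` times a Euclidean norm on any chosen coordinates plus
`b` times an `ℓ¹` norm on the others (`mixedLipschitz_of_ae_gradient`). Treating small displacements
by the first and large ones by the second, `u = exp (t F - 5 t² a²)` and `v = exp (-t F)` are
admissible for `0 ≤ t` and `t b ≤ 1 / 10`. Jensen's inequality bounds the integral of `v` from below
by `exp (-t E[F])`, hence `E[exp (t F)] ≤ exp (t E[F] + 5 t² a²)`, and Chernoff's method concludes.
-/

lemma gumbelPDF_pos (y : ℝ) : 0 < gumbelPDF y := Real.exp_pos _

lemma continuous_gumbelPDF : Continuous gumbelPDF := by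
  unfold gumbelPDF
  fun_prop

lemma measurable_ofReal_gumbelPDF : Measurable fun y => ENNReal.ofReal (gumbelPDF y) :=
  continuous_gumbelPDF.measurable.ennreal_ofReal

lemma hasDerivAt_gumbelCDF (y : ℝ) :
    HasDerivAt (fun y => Real.exp (-Real.exp (-(y + Real.eulerMascheroniConstant))))
      (gumbelPDF y) y := by
  have h := (((hasDerivAt_id' y).add_const Real.eulerMascheroniConstant).fun_neg.exp.fun_neg).exp
  convert h using 1
  rw [gumbelPDF, neg_add, Real.exp_add]
  ring

lemma lintegral_gumbelPDF : ∫⁻ y, ENNReal.ofReal (gumbelPDF y) = 1 := by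
  have h := lintegral_image_eq_lintegral_deriv_mul_of_monotoneOn (s := Set.univ)
    (f := fun y => Real.exp (-Real.exp (-(y + Real.eulerMascheroniConstant)))) (f' := gumbelPDF)
    MeasurableSet.univ (fun x _ => (hasDerivAt_gumbelCDF x).hasDerivWithinAt)
    (fun x _ y _ hxy => by dsimp only; gcongr) (fun _ => 1)
  have himage : (fun y => Real.exp (-Real.exp (-(y + Real.eulerMascheroniConstant)))) '' Set.univ
      = Set.Ioo 0 1 := by
    ext t
    simp only [Set.image_univ, Set.mem_range, Set.mem_Ioo]
    constructor
    · rintro ⟨y, rfl⟩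
      exact ⟨Real.exp_pos _, by simp [Real.exp_pos]⟩
    · rintro ⟨h0, h1⟩
      have hl : 0 < -Real.log t := by simpa using Real.log_neg h0 h1
      refine ⟨-Real.log (-Real.log t) - Real.eulerMascheroniConstant, ?_⟩
      rw [sub_add_cancel, neg_neg, Real.exp_log hl, neg_neg, Real.exp_log h0]
  rw [himage] at h
  simpa using h.symm

instance isProbabilityMeasure_gumbelMeasure : IsProbabilityMeasure gumbelMeasure :=
  ⟨by simp [gumbelMeasure, lintegral_gumbelPDF]⟩

instance isProbabilityMeasure_gumbelProduct (m : ℕ) : IsProbabilityMeasure (gumbelProduct m) := by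
  unfold gumbelProduct
  infer_instance

lemma volume_absolutelyContinuous_gumbelMeasure : (volume : Measure ℝ) ≪ gumbelMeasure :=
  withDensity_absolutelyContinuous' measurable_ofReal_gumbelPDF.aemeasurable
    (ae_of_all _ fun y => by simpa using gumbelPDF_pos y)

lemma Real.abs_le_self_add_exp_neg (t : ℝ) : |t| ≤ t + Real.exp (-t) := by
  rcases le_total 0 t with h | h
  · rw [abs_of_nonneg h]
    linarith [Real.exp_pos (-t)]
  · rw [abs_of_nonpos h]
    have := Real.quadratic_le_exp_of_nonneg (neg_nonneg.2 h)
    nlinarith [sq_nonneg (t + 1)]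

/-- Tails of exponential rate 1 on both sides leave room for the factors `exp (|x| / 10)` of
log-Lipschitz functions. -/
lemma gumbelPDF_le (y : ℝ) :
    gumbelPDF y ≤ Real.exp Real.eulerMascheroniConstant * Real.exp (-|y|) := by
  rw [gumbelPDF, ← Real.exp_add, Real.exp_le_exp]
  have h1 := Real.abs_le_self_add_exp_neg (y + Real.eulerMascheroniConstant)
  have h2 : |y| ≤ |y + Real.eulerMascheroniConstant| + Real.eulerMascheroniConstant := by
    have := abs_sub (y + Real.eulerMascheroniConstant) Real.eulerMascheroniConstant
    rw [add_sub_cancel_right] at this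
    rwa [abs_of_pos (a := Real.eulerMascheroniConstant)
      (by linarith [Real.one_half_lt_eulerMascheroniConstant])] at this
  linarith

lemma integrable_exp_neg_mul_abs {k : ℝ} (hk : 0 < k) :
    Integrable fun x : ℝ => Real.exp (-(k * |x|)) := by
  have h : Integrable fun x : ℝ => (1 + (k * x) ^ 2)⁻¹ :=
    (integrable_comp_mul_left_iff (fun x : ℝ => (1 + x ^ 2)⁻¹) hk.ne').2 integrable_inv_one_add_sq
  refine (h.const_mul 2).mono' (by fun_prop) (ae_of_all _ fun x => ?_)
  have h1 := Real.quadratic_le_exp_of_nonneg (mul_nonneg hk.le (abs_nonneg x))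
  have h2 : (k * |x|) ^ 2 = (k * x) ^ 2 := by rw [mul_pow, mul_pow, sq_abs]
  rw [Real.norm_of_nonneg (Real.exp_pos _).le, Real.exp_neg, ← div_eq_mul_inv,
    inv_le_comm₀ (Real.exp_pos _) (by positivity), inv_div]
  nlinarith [mul_nonneg hk.le (abs_nonneg x)]

/-! ### The one-dimensional inequality -/

/-- Strict differentiability is what the inverse function theorem needs in
`exists_hasDerivAt_rearrangement`. -/
lemma hasStrictDerivAt_integral_Iic {p : ℝ → ℝ} (hp : Continuous p) (hpi : Integrable p) (x : ℝ) :
    HasStrictDerivAt (fun x => ∫ t in Set.Iic x, p t) (p x) x := by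
  have h : (fun x => ∫ t in Set.Iic x, p t) =
      fun x => (∫ t in Set.Iic (0 : ℝ), p t) + ∫ t in (0 : ℝ)..x, p t := by
    ext x
    rw [intervalIntegral.integral_Iic_sub_Iic hpi.integrableOn hpi.integrableOn |>.symm]
    ring
  rw [h]
  exact (intervalIntegral.integral_hasStrictDerivAt_right (hp.intervalIntegrable _ _)
    (hp.stronglyMeasurableAtFilter _ _) hp.continuousAt).const_add _

lemma strictMono_integral_Iic {p : ℝ → ℝ} (hp : Continuous p) (hp0 : ∀ x, 0 < p x)
    (hpi : Integrable p) : StrictMono fun x => ∫ t in Set.Iic x, p t :=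
  strictMono_of_hasDerivAt_pos (fun x => (hasStrictDerivAt_integral_Iic hp hpi x).hasDerivAt) fun x => hp0 x

lemma range_integral_Iic {p : ℝ → ℝ} (hp : Continuous p) (hp0 : ∀ x, 0 < p x)
    (hpi : Integrable p) :
    Set.range (fun x => ∫ t in Set.Iic x, p t) = Set.Ioo 0 (∫ t, p t) := by
  have hmono := strictMono_integral_Iic hp hp0 hpi
  have hcont : Continuous fun x => ∫ t in Set.Iic x, p t :=
    continuous_iff_continuousAt.2 fun x => (hasStrictDerivAt_integral_Iic hp hpi x).hasDerivAt.continuousAt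
  have hbot : Tendsto (fun x => ∫ t in Set.Iic x, p t) atBot (𝓝 0) :=
    tendsto_integral_Iic_zero tendsto_id
  have htop : Tendsto (fun x => ∫ t in Set.Iic x, p t) atTop (𝓝 (∫ t, p t)) :=
    (aecover_Iic tendsto_id).integral_tendsto_of_countably_generated hpi
  apply Set.Subset.antisymm
  · rintro _ ⟨x, rfl⟩
    refine ⟨(hmono.monotone.le_of_tendsto hbot (x - 1)).trans_lt (hmono (sub_one_lt x)), ?_⟩
    exact (hmono (lt_add_one x)).trans_le (hmono.monotone.ge_of_tendsto htop (x + 1))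
  · intro y hy
    obtain ⟨x₁, h₁⟩ := (hbot.eventually_lt_const hy.1).exists
    obtain ⟨x₂, h₂⟩ := (htop.eventually_const_lt hy.2).exists
    exact mem_range_of_exists_le_of_exists_ge hcont ⟨x₁, h₁.le⟩ ⟨x₂, h₂.le⟩

lemma integral_pos_of_pos {p : ℝ → ℝ} (hp0 : ∀ x, 0 < p x) (hpi : Integrable p) :
    0 < ∫ t, p t :=
  (integral_pos_iff_support_of_nonneg (fun x => (hp0 x).le) hpi).2 (by
    rw [Set.eq_univ_of_forall fun x => Function.mem_support.2 (hp0 x).ne']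
    simp)

/-- Monotone rearrangement of one positive continuous density onto another. -/
lemma exists_hasDerivAt_rearrangement {p q : ℝ → ℝ} (hp : Continuous p) (hp0 : ∀ x, 0 < p x)
    (hpi : Integrable p) (hq : Continuous q) (hq0 : ∀ x, 0 < q x) (hqi : Integrable q) :
    ∃ T : ℝ → ℝ, ∀ x, HasDerivAt T ((q (T x))⁻¹ * (p x * ((∫ t, q t) / ∫ t, p t))) x := by
  set P := fun x => ∫ t in Set.Iic x, p t with hP
  set Q := fun x => ∫ t in Set.Iic x, q t with hQ
  have hZp := integral_pos_of_pos hp0 hpi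
  have hZq := integral_pos_of_pos hq0 hqi
  -- The two masses may differ, so `T` is defined by `Q (T x) = P x * r`.
  set r := (∫ t, q t) / ∫ t, p t with hr
  have hr0 : 0 < r := div_pos hZq hZp
  have hPr := range_integral_Iic hp hp0 hpi
  have hQr := range_integral_Iic hq hq0 hqi
  have hQm := strictMono_integral_Iic hq hq0 hqi
  have hex : ∀ x, ∃ y, Q y = P x * r := fun x => by
    have hx : P x ∈ Set.Ioo 0 (∫ t, p t) := hPr ▸ Set.mem_range_self x
    have : P x * r ∈ Set.range Q := by
      rw [hQr]
      refine ⟨mul_pos hx.1 hr0, ?_⟩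
      rw [hr, mul_div_assoc', div_lt_iff₀ hZp, mul_comm]
      exact mul_lt_mul_of_pos_left hx.2 hZq
    exact this
  choose T hT using hex
  refine ⟨T, fun x => ?_⟩
  have hP' : HasDerivAt (fun x => P x * r) (p x * r) x :=
    (hasStrictDerivAt_integral_Iic hp hpi x).hasDerivAt.mul_const r
  set I : ℝ → ℝ := Function.invFun Q with hI
  have hIQ : ∀ y, I (Q y) = y := Function.leftInverse_invFun hQm.injective
  have hQI : HasDerivAt I (q (T x))⁻¹ (P x * r) := hT x ▸
    ((hasStrictDerivAt_integral_Iic hq hqi (T x)).to_local_left_inverse (hq0 _).ne'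
      (Eventually.of_forall hIQ)).hasDerivAt
  have hTI : T = I ∘ fun x => P x * r := by
    ext x
    simp only [Function.comp, ← hT, hIQ]
  have h := hQI.comp x hP'
  rwa [← hTI] at h

/-! ### The transport cost and the skewed midpoint -/

/-- The exponential of the transport cost attached to the Gumbel distribution. -/
noncomputable def expCost (h : ℝ) : ℝ := 1 + 5 / 9 * Real.sinh (h / 3) ^ 2

lemma expCost_pos (h : ℝ) : 0 < expCost h := by
  unfold expCost
  positivity

lemma expCost_abs (h : ℝ) : expCost |h| = expCost h := by
  rcases abs_choice h with h' | h' <;> simp [h', expCost, neg_div, Real.sinh_neg]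

lemma exp_cost_le_expCost_of_nonneg {h : ℝ} (hh : 0 ≤ h) :
    Real.exp (if h ≤ 2 then h ^ 2 / 20 else h / 10) ≤ expCost h := by
  -- For `h ≤ 3` the bounds `s ≤ sinh s` and `log (1 + x) ≥ 2x / (x + 2)` suffice, with `x = 5h² /
  -- 81`.
  have hsinh : (h / 3) ^ 2 ≤ Real.sinh (h / 3) ^ 2 :=
    pow_le_pow_left₀ (by positivity) (Real.self_le_sinh_iff.2 (by positivity)) 2
  have hlog := Real.le_log_one_add_of_nonneg (x := 5 * h ^ 2 / 81) (by positivity)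
  have hsmall : Real.exp (2 * (5 * h ^ 2 / 81) / (5 * h ^ 2 / 81 + 2)) ≤ expCost h := by
    rw [Real.le_log_iff_exp_le (by positivity)] at hlog
    refine hlog.trans ?_
    rw [expCost]
    linarith
  rcases le_or_gt h 3 with h3 | h3
  · refine le_trans (Real.exp_le_exp.2 ?_) hsmall
    rw [le_div_iff₀ (by positivity)]
    split_ifs with h2
    · nlinarith [mul_nonneg (sq_nonneg h) (sub_nonneg.2 (mul_self_le_mul_self hh h2))]
    · nlinarith [mul_nonneg hh (mul_nonneg (sub_nonneg.2 (not_le.1 h2).le) (sub_nonneg.2 h3))]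
  · rw [if_neg (by linarith)]
    -- Since `6 / 10 ≤ 2 / 3`, `sinh² (h / 3)` is at least `(X ^ 6 - 2) / 4`. As `X ≥ 1.3`, the
    -- claim reduces to a quadratic inequality in `X` with negative discriminant.
    set X := Real.exp (h / 10) with hX
    have hX1 : 1.3 ≤ X := by linarith [Real.add_one_le_exp (h / 10)]
    have hX6 : X ^ 6 ≤ Real.exp (h / 3) ^ 2 := by
      rw [hX, ← Real.exp_nat_mul, ← Real.exp_nat_mul, Real.exp_le_exp]
      push_cast
      linarith
    have hX4 : (1.3 : ℝ) ^ 4 ≤ X ^ 4 := pow_le_pow_left₀ (by norm_num) hX1 4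
    have hX6' : (1.3 : ℝ) ^ 4 * X ^ 2 ≤ X ^ 6 := by
      calc (1.3 : ℝ) ^ 4 * X ^ 2 ≤ X ^ 4 * X ^ 2 := by gcongr
        _ = X ^ 6 := by ring
    have hprod : Real.exp (h / 3) * Real.exp (-(h / 3)) = 1 := by
      rw [← Real.exp_add, add_neg_cancel, Real.exp_zero]
    rw [expCost, Real.sinh_eq]
    nlinarith [sq_nonneg (X - 1.26), sq_nonneg (Real.exp (-(h / 3)))]

/-- The curvature of the Gumbel density along the skewed midpoint
`(x + y) / 2 - log (cosh ((x - y) / 3))`. -/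
lemma gumbelPDF_mul_le (x y : ℝ) :
    gumbelPDF x * gumbelPDF y * expCost (x - y) ≤
      gumbelPDF ((x + y) / 2 - Real.log (Real.cosh ((x - y) / 3))) ^ 2 *
        (1 - 4 / 9 * Real.tanh ((x - y) / 3) ^ 2) := by
  set c := Real.eulerMascheroniConstant
  set C := Real.cosh ((x - y) / 3) with hC
  have hC0 : 0 < C := Real.cosh_pos _
  -- Origin of the cost: `cosh² - (4/9) sinh² = 1 + (5/9) sinh²`.
  have h1 : expCost (x - y) = C ^ 2 * (1 - 4 / 9 * Real.tanh ((x - y) / 3) ^ 2) := by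
    rw [expCost, Real.tanh_eq_sinh_div_cosh, ← hC]
    have := Real.cosh_sq ((x - y) / 3)
    rw [← hC] at this
    field_simp
    linarith
  have h2 : Real.exp (-((x + y) / 2 - Real.log C + c)) = Real.exp (-((x + y) / 2 + c)) * C := by
    rw [show -((x + y) / 2 - Real.log C + c) = -((x + y) / 2 + c) + Real.log C by ring,
      Real.exp_add, Real.exp_log hC0]
  -- The average of the two exponential terms of the density carries the factor `cosh ((x - y) /
  -- 2)`. The skew uses the smaller rate `1 / 3`; rate `1 / 2` would still be allowed here but would
  -- reduce the cost to zero.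
  have h3 : 2 * C ≤ Real.exp ((x - y) / 2) + Real.exp (-((x - y) / 2)) := by
    have : C ≤ Real.cosh ((x - y) / 2) := by
      rw [hC, Real.cosh_le_cosh, abs_div, abs_div, abs_of_pos (by norm_num : (0 : ℝ) < 3),
        abs_of_pos (by norm_num : (0 : ℝ) < 2)]
      have := abs_nonneg (x - y)
      linarith
    rw [Real.cosh_eq] at this
    linarith
  have h4 : 2 * (Real.exp (-((x + y) / 2 + c)) * C) ≤
      Real.exp (-(x + c)) + Real.exp (-(y + c)) := by
    have ex : Real.exp (-(x + c)) = Real.exp (-((x + y) / 2 + c)) * Real.exp (-((x - y) / 2)) := by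
      rw [← Real.exp_add]; ring_nf
    have ey : Real.exp (-(y + c)) = Real.exp (-((x + y) / 2 + c)) * Real.exp ((x - y) / 2) := by
      rw [← Real.exp_add]; ring_nf
    rw [ex, ey]
    nlinarith [Real.exp_pos (-((x + y) / 2 + c))]
  -- In the exponents the linear terms agree exactly, the shift by `log C` producing `C ^ 2`; the
  -- exponential terms compare by `h4`.
  have h5 : gumbelPDF x * gumbelPDF y * C ^ 2 ≤
      gumbelPDF ((x + y) / 2 - Real.log C) ^ 2 := by
    have e : C ^ 2 = Real.exp (2 * Real.log C) := by
      rw [two_mul, Real.exp_add, Real.exp_log hC0, sq]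
    rw [e]
    unfold gumbelPDF
    rw [← Real.exp_nat_mul, ← Real.exp_add, ← Real.exp_add, Real.exp_le_exp, h2]
    push_cast
    linarith
  rw [h1, ← mul_assoc]
  refine mul_le_mul_of_nonneg_right h5 ?_
  have := Real.tanh_sq_lt_one ((x - y) / 3)
  linarith

/-- With `z x` the skewed midpoint of `x` and `T x`, the pointwise bound `key` integrates to `√(Z₁
Z₂) ≤ ∫ z' g(z) ≤ ∫ g = 1`. -/
lemma integral_mul_integral_le_one_of_continuous {u v : ℝ → ℝ} (hu : Continuous u)
    (hu0 : ∀ x, 0 < u x) (hui : Integrable fun x => u x * gumbelPDF x) (hv : Continuous v)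
    (hv0 : ∀ x, 0 < v x) (hvi : Integrable fun x => v x * gumbelPDF x)
    (huv : ∀ x y, u x * v y ≤ expCost (x - y)) :
    (∫ x, u x * gumbelPDF x) * (∫ x, v x * gumbelPDF x) ≤ 1 := by
  have hp0 : ∀ x, 0 < u x * gumbelPDF x := fun x => mul_pos (hu0 x) (gumbelPDF_pos x)
  have hq0 : ∀ x, 0 < v x * gumbelPDF x := fun x => mul_pos (hv0 x) (gumbelPDF_pos x)
  obtain ⟨T, hT⟩ := exists_hasDerivAt_rearrangement (hu.mul continuous_gumbelPDF) hp0 hui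
    (hv.mul continuous_gumbelPDF) hq0 hvi
  set Z₁ := ∫ x, u x * gumbelPDF x
  set Z₂ := ∫ x, v x * gumbelPDF x
  have hZ₁ : 0 < Z₁ := integral_pos_of_pos hp0 hui
  have hZ₂ : 0 < Z₂ := integral_pos_of_pos hq0 hvi
  set T' := fun x => (v (T x) * gumbelPDF (T x))⁻¹ * (u x * gumbelPDF x * (Z₂ / Z₁)) with hT'
  replace hT : ∀ x, HasDerivAt T (T' x) x := hT
  have hT'0 : ∀ x, 0 < T' x := fun x =>
    mul_pos (inv_pos.2 (hq0 _)) (mul_pos (hp0 x) (div_pos hZ₂ hZ₁))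
  set z := fun x => (x + T x) / 2 - Real.log (Real.cosh ((x - T x) / 3)) with hz
  set τ := fun x => Real.tanh ((x - T x) / 3) with hτ
  set z' := fun x => (1 / 2 - τ x / 3) + (1 / 2 + τ x / 3) * T' x with hz'
  have hzd : ∀ x, HasDerivAt z (z' x) x := fun x => by
    have h1 : HasDerivAt (fun x => (x - T x) / 3) ((1 - T' x) / 3) x :=
      ((hasDerivAt_id' x).fun_sub (hT x)).div_const 3
    have h2 := h1.cosh.log (Real.cosh_pos ((x - T x) / 3)).ne'
    have h3 := (((hasDerivAt_id' x).fun_add (hT x)).div_const 2).fun_sub h2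
    refine h3.congr_deriv ?_
    simp only [hz', hτ, Real.tanh_eq_sinh_div_cosh]
    ring
  have hτ1 : ∀ x, |τ x| < 1 := fun x => Real.abs_tanh_lt_one _
  have hz'0 : ∀ x, 0 < z' x := fun x => by
    have h1 := abs_lt.1 (hτ1 x)
    have h2 := mul_pos (show 0 < 1 / 2 + τ x / 3 by linarith) (hT'0 x)
    simp only [hz']
    linarith
  have hzm : StrictMono z := strictMono_of_hasDerivAt_pos hzd hz'0
  have key : ∀ x, u x * gumbelPDF x * Real.sqrt (Z₂ / Z₁) ≤ z' x * gumbelPDF (z x) := fun x => by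
    -- AM-GM: `(p + q T')² ≥ 4 p q T'` with `p, q = 1 / 2 ∓ τ / 3`, so that `4 p q = 1 - 4 τ² / 9`.
    have h1 : T' x * (1 - 4 / 9 * τ x ^ 2) ≤ z' x ^ 2 := by
      simp only [hz']
      nlinarith [sq_nonneg ((1 / 2 - τ x / 3) - (1 / 2 + τ x / 3) * T' x)]
    have h2 := gumbelPDF_mul_le x (T x)
    refine le_of_sq_le_sq ?_ (mul_pos (hz'0 x) (gumbelPDF_pos _)).le
    calc (u x * gumbelPDF x * Real.sqrt (Z₂ / Z₁)) ^ 2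
        = T' x * (gumbelPDF x * gumbelPDF (T x) * (u x * v (T x))) := by
          rw [mul_pow, Real.sq_sqrt (by positivity), hT']
          have := (hv0 (T x)).ne'
          have := (gumbelPDF_pos (T x)).ne'
          field_simp
      _ ≤ T' x * (gumbelPDF x * gumbelPDF (T x) * expCost (x - T x)) := by
          have := (hT'0 x).le
          have := (gumbelPDF_pos x).le
          have := (gumbelPDF_pos (T x)).le
          gcongr
          exact huv _ _
      _ ≤ T' x * (gumbelPDF (z x) ^ 2 * (1 - 4 / 9 * τ x ^ 2)) :=
          mul_le_mul_of_nonneg_left h2 (hT'0 x).le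
      _ = (T' x * (1 - 4 / 9 * τ x ^ 2)) * gumbelPDF (z x) ^ 2 := by ring
      _ ≤ z' x ^ 2 * gumbelPDF (z x) ^ 2 := mul_le_mul_of_nonneg_right h1 (sq_nonneg _)
      _ = (z' x * gumbelPDF (z x)) ^ 2 := by ring
  have hint : ENNReal.ofReal (Z₁ * Real.sqrt (Z₂ / Z₁)) ≤ 1 := by
    rw [← integral_mul_const, ofReal_integral_eq_lintegral_ofReal (hui.mul_const _)
      (ae_of_all _ fun x => mul_nonneg (hp0 x).le (Real.sqrt_nonneg _))]
    calc ∫⁻ x, ENNReal.ofReal (u x * gumbelPDF x * Real.sqrt (Z₂ / Z₁))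
        ≤ ∫⁻ x, ENNReal.ofReal (z' x) * ENNReal.ofReal (gumbelPDF (z x)) := by
          refine lintegral_mono fun x => ?_
          rw [← ENNReal.ofReal_mul (hz'0 x).le]
          exact ENNReal.ofReal_le_ofReal (key x)
      _ = ∫⁻ x in z '' Set.univ, ENNReal.ofReal (gumbelPDF x) := by
          rw [lintegral_image_eq_lintegral_deriv_mul_of_monotoneOn MeasurableSet.univ
            (fun x _ => (hzd x).hasDerivWithinAt) (hzm.monotone.monotoneOn _),
            Measure.restrict_univ]
      _ ≤ ∫⁻ x, ENNReal.ofReal (gumbelPDF x) := setLIntegral_le_lintegral _ _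
      _ = 1 := lintegral_gumbelPDF
  rw [ENNReal.ofReal_le_one] at hint
  calc Z₁ * Z₂ = (Z₁ * Real.sqrt (Z₂ / Z₁)) ^ 2 := by
        rw [mul_pow, Real.sq_sqrt (by positivity)]
        field_simp
    _ ≤ 1 := pow_le_one₀ (by positivity) hint

/-! ### Log-Lipschitz functions with values in `[0, ∞]` -/

/-- `u` is, up to a logarithm, `1 / 10`-Lipschitz for the `ℓ¹` distance. -/
def LogLipschitz {ι : Type*} [Fintype ι] (u : (ι → ℝ) → ENNReal) : Prop :=
  ∀ x y, u x ≤ ENNReal.ofReal (Real.exp ((∑ i, |x i - y i|) / 10)) * u y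

lemma integrable_mul_gumbelPDF {u : ℝ → ℝ} (hu : Continuous u) (hu0 : ∀ x, 0 < u x)
    (hlip : ∀ x y, u x ≤ Real.exp (|x - y| / 10) * u y) :
    Integrable fun x => u x * gumbelPDF x := by
  refine ((integrable_exp_neg_mul_abs (k := 9 / 10) (by norm_num)).const_mul
    (u 0 * Real.exp Real.eulerMascheroniConstant)).mono'
    (hu.mul continuous_gumbelPDF).aestronglyMeasurable (ae_of_all _ fun x => ?_)
  rw [Real.norm_of_nonneg (mul_pos (hu0 x) (gumbelPDF_pos x)).le]
  have h1 := hlip x 0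
  rw [sub_zero] at h1
  calc u x * gumbelPDF x
      ≤ (Real.exp (|x| / 10) * u 0) *
          (Real.exp Real.eulerMascheroniConstant * Real.exp (-|x|)) :=
        mul_le_mul h1 (gumbelPDF_le x) (gumbelPDF_pos x).le
          (mul_pos (Real.exp_pos _) (hu0 0)).le
    _ = u 0 * Real.exp Real.eulerMascheroniConstant *
          (Real.exp (|x| / 10) * Real.exp (-|x|)) := by ring
    _ = u 0 * Real.exp Real.eulerMascheroniConstant * Real.exp (-(9 / 10 * |x|)) := by
        rw [← Real.exp_add]
        ring_nf

lemma lintegral_gumbelMeasure_ofReal {u : ℝ → ℝ} (hu0 : ∀ x, 0 < u x)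
    (hui : Integrable fun x => u x * gumbelPDF x) :
    ∫⁻ x, ENNReal.ofReal (u x) ∂gumbelMeasure = ENNReal.ofReal (∫ x, u x * gumbelPDF x) := by
  rw [gumbelMeasure, lintegral_withDensity_eq_lintegral_mul_non_measurable _
      measurable_ofReal_gumbelPDF (ae_of_all _ fun _ => ENNReal.ofReal_lt_top),
    ofReal_integral_eq_lintegral_ofReal hui
      (ae_of_all _ fun x => (mul_pos (hu0 x) (gumbelPDF_pos x)).le)]
  refine lintegral_congr fun x => ?_
  rw [Pi.mul_apply, mul_comm, ENNReal.ofReal_mul (hu0 x).le]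

lemma continuous_of_le_exp_mul {u : ℝ → ℝ} (hu0 : ∀ x, 0 < u x)
    (hlip : ∀ x y, u x ≤ Real.exp (|x - y| / 10) * u y) : Continuous u := by
  have h : LipschitzWith (1 / 10) fun x => Real.log (u x) := by
    refine LipschitzWith.of_le_add_mul _ fun x y => ?_
    have := Real.log_le_log (hu0 x) (hlip x y)
    rw [Real.log_mul (Real.exp_pos _).ne' (hu0 y).ne', Real.log_exp] at this
    rw [Real.dist_eq]
    push_cast
    linarith
  have h' := h.continuous.rexp
  simpa only [Real.exp_log (hu0 _)] using h'

/-- A function that is log-Lipschitz is identically zero, identically infinite, or positive and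
finite everywhere. -/
lemma zero_or_top_or_finite {u : ℝ → ENNReal}
    (hu : ∀ x y, u x ≤ ENNReal.ofReal (Real.exp (|x - y| / 10)) * u y) :
    (∀ x, u x = 0) ∨ (∀ x, u x = ⊤) ∨ ∀ x, u x ≠ 0 ∧ u x ≠ ⊤ := by
  by_cases h0 : ∃ x, u x = 0
  · obtain ⟨y, hy⟩ := h0
    exact Or.inl fun x => by simpa [hy] using hu x y
  by_cases h1 : ∃ x, u x = ⊤
  · obtain ⟨x, hx⟩ := h1
    refine Or.inr (Or.inl fun y => ?_)
    have h := hu x y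
    rw [hx, top_le_iff, ENNReal.mul_eq_top] at h
    rcases h with h | h
    · exact h.2
    · exact absurd h.1 ENNReal.ofReal_ne_top
  push Not at h0 h1
  exact Or.inr (Or.inr fun x => ⟨h0 x, h1 x⟩)

/-- Values in `[0, ∞]` let the induction on the dimension use partial integrals without first
proving them finite. -/
lemma lintegral_mul_lintegral_le_one {u v : ℝ → ENNReal}
    (hu : ∀ x y, u x ≤ ENNReal.ofReal (Real.exp (|x - y| / 10)) * u y)
    (hv : ∀ x y, v x ≤ ENNReal.ofReal (Real.exp (|x - y| / 10)) * v y)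
    (huv : ∀ x y, u x * v y ≤ ENNReal.ofReal (expCost (x - y))) :
    (∫⁻ x, u x ∂gumbelMeasure) * (∫⁻ x, v x ∂gumbelMeasure) ≤ 1 := by
  have htop : ∀ x y, u x * v y ≠ ⊤ := fun x y => ((huv x y).trans_lt ENNReal.ofReal_lt_top).ne
  rcases zero_or_top_or_finite hu with hu0 | hut | huf
  · simp [hu0]
  · have : ∀ y, v y = 0 := fun y => by
      by_contra h
      exact htop 0 y (by rw [hut, ENNReal.top_mul h])
    simp [this]
  rcases zero_or_top_or_finite hv with hv0 | hvt | hvf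
  · simp [hv0]
  · exact absurd (by rw [hvt, ENNReal.mul_top (huf 0).1]) (htop 0 0)
  have real : ∀ w : ℝ → ENNReal, (∀ x, w x ≠ 0 ∧ w x ≠ ⊤) →
      (∀ x y, w x ≤ ENNReal.ofReal (Real.exp (|x - y| / 10)) * w y) →
      ∃ w' : ℝ → ℝ, (∀ x, 0 < w' x) ∧ (∀ x y, w' x ≤ Real.exp (|x - y| / 10) * w' y) ∧
        w = fun x => ENNReal.ofReal (w' x) := fun w hwf hw => by
    refine ⟨fun x => (w x).toReal, fun x => ENNReal.toReal_pos (hwf x).1 (hwf x).2,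
      fun x y => ?_, funext fun x => (ENNReal.ofReal_toReal (hwf x).2).symm⟩
    have h := ENNReal.toReal_mono (ENNReal.mul_ne_top ENNReal.ofReal_ne_top (hwf y).2) (hw x y)
    rwa [ENNReal.toReal_mul, ENNReal.toReal_ofReal (Real.exp_pos _).le] at h
  obtain ⟨u', hu0, hul, rfl⟩ := real u huf hu
  obtain ⟨v', hv0, hvl, rfl⟩ := real v hvf hv
  have huc := continuous_of_le_exp_mul hu0 hul
  have hvc := continuous_of_le_exp_mul hv0 hvl
  have hui := integrable_mul_gumbelPDF huc hu0 hul
  have hvi := integrable_mul_gumbelPDF hvc hv0 hvl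
  rw [lintegral_gumbelMeasure_ofReal hu0 hui, lintegral_gumbelMeasure_ofReal hv0 hvi,
    ← ENNReal.ofReal_mul (integral_nonneg fun x => (mul_pos (hu0 x) (gumbelPDF_pos x)).le),
    ENNReal.ofReal_le_one]
  refine integral_mul_integral_le_one_of_continuous huc hu0 hui hvc hv0 hvi fun x y => ?_
  have h := huv x y
  rwa [← ENNReal.ofReal_mul (hu0 x).le, ENNReal.ofReal_le_ofReal_iff (expCost_pos _).le] at h

/-! ### Tensorisation -/

lemma lintegral_gumbelProduct_succ {n : ℕ} {u : (Fin (n + 1) → ℝ) → ENNReal}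
    (hu : Measurable u) :
    ∫⁻ x, u x ∂gumbelProduct (n + 1) =
      ∫⁻ s, ∫⁻ y, u (Fin.cons s y) ∂gumbelProduct n ∂gumbelMeasure := by
  have h := measurePreserving_piFinSuccAbove (fun _ : Fin (n + 1) => gumbelMeasure) 0
  rw [gumbelProduct, ← h.symm.lintegral_comp hu, lintegral_prod _ (by fun_prop)]
  simp only [MeasurableEquiv.piFinSuccAbove_symm_apply, Fin.insertNthEquiv_zero]
  rfl

lemma measurable_cons_comp {n : ℕ} {u : (Fin (n + 1) → ℝ) → ENNReal} (hu : Measurable u) :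
    Measurable fun p : ℝ × (Fin n → ℝ) => u (Fin.cons p.1 p.2) :=
  hu.comp (measurable_pi_iff.2 fun i => by
    refine Fin.cases ?_ (fun i => ?_) i
    · simpa using measurable_fst
    · simp only [Fin.cons_succ]
      fun_prop)

/-- The two-function (dual) form of the transport inequality for the Gumbel product measure. -/
theorem lintegral_mul_lintegral_gumbelProduct_le_one {m : ℕ} {u v : (Fin m → ℝ) → ENNReal}
    (hum : Measurable u) (hvm : Measurable v) (hu : LogLipschitz u) (hv : LogLipschitz v)
    (huv : ∀ x y, u x * v y ≤ ENNReal.ofReal (∏ i, expCost (x i - y i))) :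
    (∫⁻ x, u x ∂gumbelProduct m) * (∫⁻ x, v x ∂gumbelProduct m) ≤ 1 := by
  induction m with
  | zero =>
    have h0 := huv default default
    rw [Finset.univ_eq_empty, Finset.prod_empty, ENNReal.ofReal_one] at h0
    have h : ∀ w : (Fin 0 → ℝ) → ENNReal, ∫⁻ x, w x ∂gumbelProduct 0 = w default := fun w => by
      rw [lintegral_unique, measure_univ, mul_one]
      exact congrArg w (Subsingleton.elim _ _)
    rwa [h, h]
  | succ n ih =>
    rw [lintegral_gumbelProduct_succ hum, lintegral_gumbelProduct_succ hvm]
    have hlip : ∀ w : (Fin (n + 1) → ℝ) → ENNReal, Measurable w → LogLipschitz w → ∀ s t : ℝ,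
        ∫⁻ y, w (Fin.cons s y) ∂gumbelProduct n ≤ ENNReal.ofReal (Real.exp (|s - t| / 10)) *
          ∫⁻ y, w (Fin.cons t y) ∂gumbelProduct n := fun w hwm hw s t => by
      rw [← lintegral_const_mul' _ _ ENNReal.ofReal_ne_top]
      refine lintegral_mono fun y => ?_
      simpa [Fin.sum_univ_succ] using hw (Fin.cons s y) (Fin.cons t y)
    have hslice : ∀ w : (Fin (n + 1) → ℝ) → ENNReal, LogLipschitz w → ∀ s : ℝ,
        LogLipschitz fun y : Fin n → ℝ => w (Fin.cons s y) := fun w hw s x y => by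
      simpa [Fin.sum_univ_succ] using hw (Fin.cons s x) (Fin.cons s y)
    refine lintegral_mul_lintegral_le_one (hlip u hum hu) (hlip v hvm hv) fun s t => ?_
    have hc0 : ENNReal.ofReal (expCost (s - t)) ≠ 0 := by simpa using expCost_pos (s - t)
    -- Dividing the slice of `u` at `s` by the cost of the first coordinate makes the slices at `s`
    -- and `t` admissible in dimension `n`. The partial integrals then satisfy the one-dimensional
    -- hypothesis.
    have h := ih (u := fun y => (ENNReal.ofReal (expCost (s - t)))⁻¹ * u (Fin.cons s y))
      (v := fun y => v (Fin.cons t y))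
      (((measurable_cons_comp hum).comp measurable_prodMk_left).const_mul _)
      ((measurable_cons_comp hvm).comp measurable_prodMk_left)
      (fun x y => by
        rw [mul_left_comm]
        exact mul_le_mul_right (hslice u hu s x y) _)
      (hslice v hv t) (fun x y => by
        have h := huv (Fin.cons s x) (Fin.cons t y)
        rw [Fin.prod_univ_succ, ENNReal.ofReal_mul (expCost_pos _).le] at h
        rw [mul_assoc, ENNReal.inv_mul_le_iff hc0 ENNReal.ofReal_ne_top]
        simpa using h)
    rwa [lintegral_const_mul' _ _ (ENNReal.inv_ne_top.2 hc0), mul_assoc,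
      ENNReal.inv_mul_le_iff hc0 ENNReal.ofReal_ne_top, mul_one] at h

/-! ### Exponential moments under a mixed Lipschitz bound -/

/-- The increments of `F` are controlled by `a` times the Euclidean norm on any set of coordinates
plus `b` times the `ℓ¹` norm on the others. -/
def MixedLipschitz {m : ℕ} (F : (Fin m → ℝ) → ℝ) (a b : ℝ) : Prop :=
  ∀ (S : Finset (Fin m)) (x y : Fin m → ℝ),
    F x - F y ≤ a * Real.sqrt (∑ i ∈ S, (x i - y i) ^ 2) + b * ∑ i ∈ Sᶜ, |x i - y i|

lemma exp_cost_le_expCost (h : ℝ) :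
    Real.exp (if |h| ≤ 2 then h ^ 2 / 20 else |h| / 10) ≤ expCost h := by
  have := exp_cost_le_expCost_of_nonneg (abs_nonneg h)
  rwa [sq_abs, expCost_abs] at this

namespace MixedLipschitz

variable {m : ℕ} {F : (Fin m → ℝ) → ℝ} {a b t : ℝ}

lemma neg (hF : MixedLipschitz F a b) : MixedLipschitz (fun x => -F x) a b := fun S x y => by
  have h := hF S y x
  simp only [sub_sq_comm (y _), abs_sub_comm (y _)] at h
  linarith

lemma sub_le (hF : MixedLipschitz F a b) (x y : Fin m → ℝ) :
    F x - F y ≤ b * ∑ i, |x i - y i| := by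
  simpa using hF ∅ x y

lemma mul_sub_le (hF : MixedLipschitz F a b) (ht : 0 ≤ t) (htb : t * b ≤ 1 / 10)
    (x y : Fin m → ℝ) : t * F x - t * F y ≤ (∑ i, |x i - y i|) / 10 := by
  have h1 := mul_le_mul_of_nonneg_left (hF.sub_le x y) ht
  have h2 := mul_le_mul_of_nonneg_right htb
    (Finset.sum_nonneg fun i _ => abs_nonneg (x i - y i) : 0 ≤ ∑ i, |x i - y i|)
  linarith

lemma logLipschitz (hF : MixedLipschitz F a b) (ht : 0 ≤ t) (htb : t * b ≤ 1 / 10) (k : ℝ) :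
    LogLipschitz fun x => ENNReal.ofReal (Real.exp (t * F x - k)) := fun x y => by
  rw [← ENNReal.ofReal_mul (Real.exp_pos _).le, ← Real.exp_add]
  refine ENNReal.ofReal_le_ofReal (Real.exp_le_exp.2 ?_)
  linarith [hF.mul_sub_le ht htb x y]

lemma exp_sub_le_prod (hF : MixedLipschitz F a b) (ht : 0 ≤ t) (htb : t * b ≤ 1 / 10)
    (x y : Fin m → ℝ) :
    Real.exp (t * F x - t * F y - 5 * t ^ 2 * a ^ 2) ≤ ∏ i, expCost (x i - y i) := by
  refine le_trans ?_ (Finset.prod_le_prod (fun i _ => (Real.exp_pos _).le)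
    fun i _ => exp_cost_le_expCost (x i - y i))
  rw [← Real.exp_sum, Real.exp_le_exp, Finset.sum_ite, ← Finset.sum_div, ← Finset.sum_div,
    ← Finset.compl_filter]
  -- On `S` the cost is quadratic, and `t a s ≤ 5 t² a² + s² / 20` with `s` the Euclidean norm. Off
  -- `S` it is linear, and `t b ≤ 1 / 10` suffices.
  set S := Finset.univ.filter fun i => |x i - y i| ≤ 2
  have h1 := mul_le_mul_of_nonneg_left (hF S x y) ht
  have h2 := Real.sq_sqrt (Finset.sum_nonneg fun i _ => sq_nonneg (x i - y i) :
    0 ≤ ∑ i ∈ S, (x i - y i) ^ 2)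
  have h3 := mul_le_mul_of_nonneg_right htb
    (Finset.sum_nonneg fun i _ => abs_nonneg (x i - y i) : 0 ≤ ∑ i ∈ Sᶜ, |x i - y i|)
  nlinarith [sq_nonneg (10 * t * a - Real.sqrt (∑ i ∈ S, (x i - y i) ^ 2))]

lemma lintegral_exp_mul_lintegral_exp_neg_le (hF : MixedLipschitz F a b) (hFc : Continuous F)
    (ht : 0 ≤ t) (htb : t * b ≤ 1 / 10) :
    (∫⁻ x, ENNReal.ofReal (Real.exp (t * F x)) ∂gumbelProduct m) *
      (∫⁻ x, ENNReal.ofReal (Real.exp (-(t * F x))) ∂gumbelProduct m) ≤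
      ENNReal.ofReal (Real.exp (5 * t ^ 2 * a ^ 2)) := by
  have h := lintegral_mul_lintegral_gumbelProduct_le_one
    (u := fun x => ENNReal.ofReal (Real.exp (t * F x - 5 * t ^ 2 * a ^ 2)))
    -- The term `- 0` gives `v` the shape required by `logLipschitz` for `-F`.
    (v := fun x => ENNReal.ofReal (Real.exp (t * -F x - 0)))
    (by fun_prop) (by fun_prop) (hF.logLipschitz ht htb _) (hF.neg.logLipschitz ht htb _)
    (fun x y => by
      rw [← ENNReal.ofReal_mul (Real.exp_pos _).le, ← Real.exp_add]
      refine ENNReal.ofReal_le_ofReal (le_trans (Real.exp_le_exp.2 ?_)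
        (hF.exp_sub_le_prod ht htb x y))
      linarith)
  have e1 : ∀ x, ENNReal.ofReal (Real.exp (t * F x)) =
      ENNReal.ofReal (Real.exp (5 * t ^ 2 * a ^ 2)) *
        ENNReal.ofReal (Real.exp (t * F x - 5 * t ^ 2 * a ^ 2)) := fun x => by
    rw [← ENNReal.ofReal_mul (Real.exp_pos _).le, ← Real.exp_add]
    ring_nf
  simp only [sub_zero, mul_neg] at h
  simp_rw [e1]
  rw [lintegral_const_mul' _ _ ENNReal.ofReal_ne_top, mul_assoc]
  exact mul_le_of_le_one_right' h

/-- The product of the two exponential integrals is finite and the second factor is nonzero, so the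
first is finite. -/
lemma integrable_exp (hF : MixedLipschitz F a b) (hFc : Continuous F) (ht : 0 ≤ t)
    (htb : t * b ≤ 1 / 10) : Integrable (fun x => Real.exp (t * F x)) (gumbelProduct m) := by
  refine ⟨by fun_prop, ?_⟩
  rw [hasFiniteIntegral_iff_ofReal (ae_of_all _ fun x => (Real.exp_pos _).le)]
  have h := hF.lintegral_exp_mul_lintegral_exp_neg_le hFc ht htb
  refine ENNReal.lt_top_of_mul_ne_top_left (h.trans_lt ENNReal.ofReal_lt_top).ne ?_
  rw [Ne, lintegral_eq_zero_iff (by fun_prop)]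
  intro h0
  obtain ⟨x, hx⟩ := h0.exists
  exact (Real.exp_pos _).not_ge (ENNReal.ofReal_eq_zero.1 hx)

lemma integrable_exp_neg (hF : MixedLipschitz F a b) (hFc : Continuous F) (ht : 0 ≤ t)
    (htb : t * b ≤ 1 / 10) : Integrable (fun x => Real.exp (-(t * F x))) (gumbelProduct m) := by
  simpa only [mul_neg] using hF.neg.integrable_exp hFc.neg ht htb

lemma integrable (hF : MixedLipschitz F a b) (hFc : Continuous F) (hb : 0 < b) :
    Integrable F (gumbelProduct m) := by
  have ht : 0 < 1 / (10 * b) := by positivity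
  have htb : 1 / (10 * b) * b ≤ 1 / 10 := by
    rw [div_mul_eq_mul_div, one_mul, div_le_iff₀ (by positivity)]
    linarith
  refine (((hF.integrable_exp hFc ht.le htb).add (hF.integrable_exp_neg hFc ht.le htb)).const_mul
    (10 * b)).mono' hFc.aestronglyMeasurable (ae_of_all _ fun x => ?_)
  set s := 1 / (10 * b) * F x with hs
  have hFs : F x = 10 * b * s := by
    rw [hs]
    field_simp
  rw [hFs, norm_mul, Real.norm_of_nonneg (by positivity : 0 ≤ 10 * b), Real.norm_eq_abs]
  refine mul_le_mul_of_nonneg_left ?_ (by positivity)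
  rw [Pi.add_apply, ← hs]
  rcases abs_cases s with h | h
  · linarith [Real.add_one_le_exp s, Real.exp_pos (-s)]
  · linarith [Real.add_one_le_exp (-s), Real.exp_pos s]

/-- Jensen's inequality bounds the factor `∫ exp (-t F)` from below; dividing by it leaves the
moment bound. -/
lemma integral_exp_le (hF : MixedLipschitz F a b) (hFc : Continuous F) (hb : 0 < b) (ht : 0 ≤ t)
    (htb : t * b ≤ 1 / 10) :
    ∫ x, Real.exp (t * F x) ∂gumbelProduct m ≤
      Real.exp (t * (∫ x, F x ∂gumbelProduct m) + 5 * t ^ 2 * a ^ 2) := by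
  have hi := hF.integrable hFc hb
  have h1 := hF.integrable_exp hFc ht htb
  have h2 := hF.integrable_exp_neg hFc ht htb
  have h := hF.lintegral_exp_mul_lintegral_exp_neg_le hFc ht htb
  rw [← ofReal_integral_eq_lintegral_ofReal h1 (ae_of_all _ fun x => (Real.exp_pos _).le),
    ← ofReal_integral_eq_lintegral_ofReal h2 (ae_of_all _ fun x => (Real.exp_pos _).le),
    ← ENNReal.ofReal_mul (integral_nonneg fun x => (Real.exp_pos _).le),
    ENNReal.ofReal_le_ofReal_iff (Real.exp_pos _).le] at h
  have hj : Real.exp (-(t * ∫ x, F x ∂gumbelProduct m)) ≤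
      ∫ x, Real.exp (-(t * F x)) ∂gumbelProduct m := by
    have := convexOn_exp.map_integral_le (μ := gumbelProduct m) (f := fun x => -(t * F x))
      Real.continuous_exp.continuousOn isClosed_univ (ae_of_all _ fun _ => Set.mem_univ _)
      (hi.const_mul t).neg h2
    rwa [integral_neg, integral_const_mul] at this
  have h3 := (mul_le_mul_of_nonneg_left hj
    (integral_nonneg fun x => (Real.exp_pos (t * F x)).le)).trans h
  rw [Real.exp_neg, ← div_eq_mul_inv, div_le_iff₀ (Real.exp_pos _), ← Real.exp_add] at h3
  rwa [add_comm]

end MixedLipschitz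

/-! ### Chernoff bound -/

/-- Chernoff bound for i.i.d. copies of a function with the mixed Lipschitz property. -/
theorem MixedLipschitz.measureReal_deviation_le {m : ℕ} {F : (Fin m → ℝ) → ℝ} {a b : ℝ}
    (hF : MixedLipschitz F a b) (hFc : Continuous F) (ha : 0 < a) (hb : 0 < b)
    {Ω : Type*} [MeasurableSpace Ω] (P : Measure Ω) [IsProbabilityMeasure P]
    {M : ℕ} (hM : 1 ≤ M) (η : Fin M → Ω → ℝ) (hη_indep : iIndepFun η P)
    (hη_law : ∀ j, IdentDistrib (η j) F P (gumbelProduct m))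
    (δ : ℝ) (hδ0 : 0 < δ) (hδ1 : δ < 1) :
    1 - δ ≤ P.real {ω | (1 / (M : ℝ)) * (∑ j, η j ω) - (∫ y, F y ∂(gumbelProduct m)) ≤
      max (20 * b / M * Real.log (1 / δ)) (Real.sqrt (20 * a ^ 2 / M * Real.log (1 / δ)))} := by
  set E := ∫ y, F y ∂gumbelProduct m
  set ℓ := Real.log (1 / δ) with hℓ
  have hℓ0 : 0 < ℓ := Real.log_pos (by rw [lt_div_iff₀ hδ0]; linarith)
  have hM0 : (0 : ℝ) < M := by exact_mod_cast hM
  set r := max (20 * b / M * ℓ) (Real.sqrt (20 * a ^ 2 / M * ℓ)) with hr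
  have hr1 : 20 * b * ℓ ≤ M * r := by
    have h := le_max_left (20 * b / M * ℓ) (Real.sqrt (20 * a ^ 2 / M * ℓ))
    rw [← hr, div_mul_eq_mul_div, div_le_iff₀ hM0] at h
    linarith
  have hr0 : 0 < r := lt_max_of_lt_left (by positivity)
  have hr2 : 20 * a ^ 2 * ℓ ≤ M * r ^ 2 := by
    have h := Real.sqrt_le_left hr0.le |>.1 (le_max_right (20 * b / M * ℓ)
      (Real.sqrt (20 * a ^ 2 / M * ℓ)))
    rw [div_mul_eq_mul_div, div_le_iff₀ hM0] at h
    linarith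
  obtain ⟨t, ht0, htb, hrate⟩ : ∃ t : ℝ, 0 ≤ t ∧ t * b ≤ 1 / 10 ∧
      ℓ ≤ M * (t * r - 5 * t ^ 2 * a ^ 2) := by
    -- The unconstrained maximiser of `t r - 5 t² a²` is `r / (10 a²)`, with value `r² / (20 a²)`.
    -- When it exceeds the limit `1 / (10 b)`, the limit itself gives at least `r / (20 b)`. These
    -- two rates match the two terms of the maximum.
    rcases le_total (r * b) (a ^ 2) with h | h
    · refine ⟨r / (10 * a ^ 2), by positivity, ?_, ?_⟩
      · rw [div_mul_eq_mul_div, div_le_iff₀ (by positivity)]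
        linarith
      · have e : (M : ℝ) * (r / (10 * a ^ 2) * r - 5 * (r / (10 * a ^ 2)) ^ 2 * a ^ 2) =
            M * r ^ 2 / (20 * a ^ 2) := by
          field_simp
          ring
        rw [e, le_div_iff₀ (by positivity)]
        linarith
    · refine ⟨1 / (10 * b), by positivity, ?_, ?_⟩
      · rw [div_mul_eq_mul_div, div_le_iff₀ (by positivity)]
        linarith
      · have e : 1 / (10 * b) * r - 5 * (1 / (10 * b)) ^ 2 * a ^ 2 =
            (2 * (r * b) - a ^ 2) / (20 * b ^ 2) := by
          field_simp
          ring
        rw [e, mul_div_assoc', le_div_iff₀ (by positivity)]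
        nlinarith [mul_le_mul_of_nonneg_left h hM0.le, mul_le_mul_of_nonneg_right hr1 hb.le]
  have hηm : ∀ j, AEMeasurable (η j) P := fun j => (hη_law j).aemeasurable_fst
  have hexp : Measurable fun s : ℝ => Real.exp (t * s) := by fun_prop
  have hmgf : ∀ j, mgf (η j) P t ≤ Real.exp (t * E + 5 * t ^ 2 * a ^ 2) := fun j => by
    exact ((hη_law j).comp hexp).integral_eq.trans_le (hF.integral_exp_le hFc hb ht0 htb)
  have hint : ∀ j, Integrable (fun ω => Real.exp (t * η j ω)) P := fun j =>
    ((hη_law j).comp hexp).integrable_iff.2 (hF.integrable_exp hFc ht0 htb)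
  have hsum : Integrable (fun ω => Real.exp (t * (∑ j, η j) ω)) P := by
    -- A non-integrable exponential would have `mgf` equal to 0 by convention, whereas the product
    -- of the individual ones is positive.
    by_contra h
    have h0 : mgf (∑ j, η j) P t = 0 := mgf_undef h
    rw [iIndepFun.mgf_sum₀ hη_indep hηm] at h0
    exact (Finset.prod_pos fun j _ => mgf_pos (hint j)).ne' h0
  have hch := measure_ge_le_exp_mul_mgf (M * (E + r)) ht0 hsum
  rw [iIndepFun.mgf_sum₀ hη_indep hηm] at hch
  have hprod : ∏ j, mgf (η j) P t ≤ Real.exp (M * (t * E + 5 * t ^ 2 * a ^ 2)) := by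
    refine (Finset.prod_le_prod (fun j _ => mgf_nonneg) fun j _ => hmgf j).trans_eq ?_
    rw [Finset.prod_const, Finset.card_univ, Fintype.card_fin, Real.exp_nat_mul]
  have htail : P.real {ω | M * (E + r) ≤ (∑ j, η j) ω} ≤ δ := by
    refine hch.trans ((mul_le_mul_of_nonneg_left hprod (Real.exp_pos _).le).trans ?_)
    rw [← Real.exp_add, ← Real.le_log_iff_exp_le hδ0]
    rw [hℓ, one_div, Real.log_inv] at hrate
    linarith
  have hcover : (Set.univ : Set Ω) ⊆ {ω | (1 / (M : ℝ)) * (∑ j, η j ω) - E ≤ r} ∪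
      {ω | M * (E + r) ≤ (∑ j, η j) ω} := fun ω _ => by
    rcases le_or_gt ((1 / (M : ℝ)) * (∑ j, η j ω) - E) r with h | h
    · exact Or.inl h
    · refine Or.inr ?_
      rw [Set.mem_ofPred_eq, Finset.sum_apply, mul_comm, ← le_div_iff₀ hM0]
      rw [one_div_mul_eq_div] at h
      linarith
  have h1 := (measureReal_mono hcover (measure_ne_top P _)).trans (measureReal_union_le _ _)
  rw [probReal_univ] at h1
  linarith

/-! ### From gradient bounds to increments -/

/-- Transfers the almost-everywhere hypotheses to Lebesgue measure, which is translation invariant.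
-/
lemma volume_absolutelyContinuous_gumbelProduct (m : ℕ) :
    (volume : Measure (Fin m → ℝ)) ≪ gumbelProduct m := by
  induction m with
  | zero =>
    rw [gumbelProduct, volume_pi, Measure.pi_of_empty, Measure.pi_of_empty]
  | succ n ih =>
    have hv := (measurePreserving_piFinSuccAbove
      (fun _ : Fin (n + 1) => (volume : Measure ℝ)) 0).symm
    have hg := (measurePreserving_piFinSuccAbove (fun _ : Fin (n + 1) => gumbelMeasure) 0).symm
    rw [gumbelProduct, volume_pi, ← hv.map_eq, ← hg.map_eq]
    exact (volume_absolutelyContinuous_gumbelMeasure.prod ih).map hv.measurable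

/-- Translation invariance gives the property for almost every `x` at each fixed `t`; Fubini
exchanges the quantifiers. The exceptional set is enlarged to a measurable null set for this
purpose. -/
lemma ae_ae_add_smul {m : ℕ} {p : (Fin m → ℝ) → Prop} (hp : ∀ᵐ x, p x) (h : Fin m → ℝ) :
    ∀ᵐ x : Fin m → ℝ, ∀ᵐ t : ℝ, p (x + t • h) := by
  set N := toMeasurable volume {x | ¬p x}
  have hN : volume N = 0 := (measure_toMeasurable _).trans hp
  have hmeas : MeasurableSet {q : ℝ × (Fin m → ℝ) | q.2 + q.1 • h ∉ N} :=
    ((measurableSet_toMeasurable _ _).compl).preimage (by fun_prop)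
  have hN' : ∀ᵐ t : ℝ, ∀ᵐ x : Fin m → ℝ, x + t • h ∉ N := ae_of_all _ fun t =>
    (measurePreserving_add_right volume (t • h)).quasiMeasurePreserving.ae
      (measure_eq_zero_iff_ae_notMem.1 hN)
  rw [Measure.ae_ae_comm (p := fun (t : ℝ) (x : Fin m → ℝ) => x + t • h ∉ N) hmeas] at hN'
  filter_upwards [hN'] with x hx
  filter_upwards [hx] with t ht
  by_contra hpt
  exact ht (subset_toMeasurable _ _ hpt)

lemma forall_of_ae_le {m : ℕ} {f g : (Fin m → ℝ) → ℝ} (hf : Continuous f) (hg : Continuous g)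
    (h : ∀ᵐ x, f x ≤ g x) (x : Fin m → ℝ) : f x ≤ g x := by
  have hd : Dense {x | f x ≤ g x} := Measure.dense_of_ae h
  have hc : IsClosed {x | f x ≤ g x} := isClosed_le hf hg
  have : x ∈ closure {x | f x ≤ g x} := hd x
  rwa [hc.closure_eq] at this

lemma AbsolutelyContinuousOnInterval.abs_sub_le {f : ℝ → ℝ} {s t C : ℝ}
    (hf : AbsolutelyContinuousOnInterval f s t) (hC : ∀ᵐ x, |deriv f x| ≤ C) :
    |f t - f s| ≤ C * |t - s| := by
  rw [← hf.integral_deriv_eq_sub, ← Real.norm_eq_abs]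
  refine intervalIntegral.norm_integral_le_of_norm_le_const_ae ?_
  filter_upwards [hC] with x hx _ using hx

section

variable {m : ℕ} {F : (Fin m → ℝ) → ℝ} {a b : ℝ}

lemma hasDerivAt_comp_add_smul {x h : Fin m → ℝ} {t : ℝ}
    (hF : DifferentiableAt ℝ F (x + t • h)) :
    HasDerivAt (fun t : ℝ => F (x + t • h)) (fderiv ℝ F (x + t • h) h) t := by
  have h1 : HasDerivAt (fun t : ℝ => x + t • h) h t := by
    simpa using ((hasDerivAt_id t).smul_const h).const_add x
  exact hF.hasFDerivAt.comp_hasDerivAt t h1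

lemma update_eq_add_smul (y : Fin m → ℝ) (i : Fin m) (t : ℝ) :
    Function.update y i t = y + (t - y i) • Pi.single i 1 := by
  ext j
  rcases eq_or_ne j i with rfl | hj
  · simp
  · simp [hj]

/-- For a fixed increment, integrating the derivative along almost every coordinate line gives the
bound for almost every `y`; continuity extends it to all `y`. -/
lemma abs_update_sub_le (hFc : Continuous F) (hac : ACOnCoordinateLines F)
    (hd : ∀ᵐ y, DifferentiableAt ℝ F y ∧ ∀ i, |partialDeriv F i y| ≤ b) (i : Fin m)
    (y : Fin m → ℝ) (t : ℝ) : |F (Function.update y i t) - F y| ≤ b * |t - y i| := by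
  have key : ∀ r : ℝ, ∀ y : Fin m → ℝ, |F (y + r • Pi.single i 1) - F y| ≤ b * |r| := fun r => by
    refine forall_of_ae_le (by fun_prop) (by fun_prop) ?_
    filter_upwards [hac i, ae_ae_add_smul hd (Pi.single i 1)] with y hy hyd
    have hyd' : ∀ᵐ s : ℝ, |deriv (fun x => F (Function.update y i x)) s| ≤ b := by
      filter_upwards [(measurePreserving_sub_right volume (y i)).quasiMeasurePreserving.ae hyd]
        with s hs
      have h1 := (hasDerivAt_comp_add_smul hs.1).comp_sub_const s (y i)
      simp only [← update_eq_add_smul] at h1 hs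
      rw [h1.deriv]
      exact hs.2 i
    have h := (hy (y i) (y i + r)).abs_sub_le hyd'
    simpa [update_eq_add_smul] using h
  rw [update_eq_add_smul]
  exact key _ _

lemma abs_sub_le_mul_sum (h : ∀ i y t, |F (Function.update y i t) - F y| ≤ b * |t - y i|)
    (x y : Fin m → ℝ) : |F x - F y| ≤ b * ∑ i, |x i - y i| := by
  have key : ∀ S : Finset (Fin m), |F (S.piecewise x y) - F y| ≤ b * ∑ i ∈ S, |x i - y i| :=
    fun S => by
      induction S using Finset.induction_on with
      | empty => simp
      | insert j S hj ih =>
        rw [Finset.piecewise_insert, Finset.sum_insert hj]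
        have h1 := h j (S.piecewise x y) (x j)
        rw [Finset.piecewise_eq_of_notMem S x y hj] at h1
        have h2 := abs_sub_le (F (Function.update (S.piecewise x y) j (x j)))
          (F (S.piecewise x y)) (F y)
        linarith
  simpa using key Finset.univ

/-- Absolute continuity is assumed on coordinate lines only. It first yields an `ℓ¹` Lipschitz
bound, which makes `F` Lipschitz, hence absolutely continuous, on lines in the direction `x - y`.
There the derivative is bounded by Cauchy–Schwarz on `S` and by the sup bound off `S`. -/
theorem mixedLipschitz_of_ae_gradient (hFc : Continuous F) (hac : ACOnCoordinateLines F)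
    (ha : 0 ≤ a) (hd : ∀ᵐ y, DifferentiableAt ℝ F y ∧
      ∑ i, (partialDeriv F i y) ^ 2 ≤ a ^ 2 ∧ ∀ i, |partialDeriv F i y| ≤ b) :
    MixedLipschitz F a b := by
  have hlip := abs_sub_le_mul_sum
    (abs_update_sub_le hFc hac (hd.mono fun y hy => ⟨hy.1, hy.2.2⟩))
  intro S x y
  set h := x - y with hh
  set C := a * Real.sqrt (∑ i ∈ S, (x i - y i) ^ 2) + b * ∑ i ∈ Sᶜ, |x i - y i| with hC
  have hgrad : ∀ᵐ z, DifferentiableAt ℝ F z ∧ |fderiv ℝ F z h| ≤ C := by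
    filter_upwards [hd] with z ⟨hz, hz2, hzi⟩
    refine ⟨hz, ?_⟩
    have e : fderiv ℝ F z h = ∑ i, h i * partialDeriv F i z := by
      conv_lhs => rw [pi_eq_sum_univ' h]
      simp [partialDeriv, map_sum]
    rw [e, ← Finset.sum_add_sum_compl S]
    refine (abs_add_le _ _).trans (add_le_add ?_ ?_)
    · refine Real.abs_le_sqrt (Finset.sum_mul_sq_le_sq_mul_sq S _ _) |>.trans ?_
      rw [Real.sqrt_mul (Finset.sum_nonneg fun i _ => sq_nonneg _), mul_comm]
      refine mul_le_mul_of_nonneg_right ?_ (Real.sqrt_nonneg _)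
      rw [Real.sqrt_le_left ha]
      exact (Finset.sum_le_sum_of_subset_of_nonneg (Finset.subset_univ S)
        fun i _ _ => sq_nonneg _).trans hz2
    · rw [Finset.mul_sum]
      refine (Finset.abs_sum_le_sum_abs _ _).trans (Finset.sum_le_sum fun i _ => ?_)
      rw [abs_mul, mul_comm]
      exact mul_le_mul_of_nonneg_right (hzi i) (abs_nonneg _)
  have key : ∀ z : Fin m → ℝ, |F (z + h) - F z| ≤ C := by
    refine forall_of_ae_le (by fun_prop) (by fun_prop) ?_
    filter_upwards [ae_ae_add_smul hgrad h] with z hz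
    have hL : LipschitzWith (Real.toNNReal (b * ∑ i, |h i|)) fun t : ℝ => F (z + t • h) :=
      LipschitzWith.of_dist_le' fun s t => by
        have h1 := hlip (z + s • h) (z + t • h)
        simp only [Pi.add_apply, Pi.smul_apply, smul_eq_mul, add_sub_add_left_eq_sub, ← sub_mul,
          abs_mul, ← Finset.mul_sum] at h1
        rw [Real.dist_eq, Real.dist_eq]
        linarith
    have h1 := (hL.lipschitzOnWith (s := Set.uIcc 0 1)).absolutelyContinuousOnInterval.abs_sub_le
      (C := C) (by
        filter_upwards [hz] with t ht
        rw [(hasDerivAt_comp_add_smul ht.1).deriv]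
        exact ht.2)
    simpa using h1
  have h1 := key y
  rw [hh, add_sub_cancel] at h1
  exact (le_abs_self _).trans h1

end

/-! ### The concentration inequality -/

theorem corollary2 {m : ℕ} (F : (Fin m → ℝ) → ℝ) (a b : ℝ)
    (hF_cont : Continuous F)
    (hF_ac : ACOnCoordinateLines F)
    (hF_grad : ∀ᵐ y ∂(gumbelProduct m), DifferentiableAt ℝ F y ∧
      ∑ i, (partialDeriv F i y) ^ 2 ≤ a ^ 2 ∧ ∀ i, |partialDeriv F i y| ≤ b)
    (hF_decay : ∀ (i : Fin m) (y : Fin m → ℝ),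
      Tendsto (fun t : ℝ => F (Function.update y i t) *
        ∏ k, gumbelPDF (Function.update y i t k)) atTop (𝓝 0) ∧
      Tendsto (fun t : ℝ => F (Function.update y i t) *
        ∏ k, gumbelPDF (Function.update y i t k)) atBot (𝓝 0))
    {Ω : Type*} [MeasurableSpace Ω] (P : Measure Ω) [IsProbabilityMeasure P]
    {M : ℕ} (hM : 1 ≤ M) (η : Fin M → Ω → ℝ)
    (hη_indep : iIndepFun η P)
    (hη_law : ∀ j, IdentDistrib (η j) F P (gumbelProduct m))
    (δ : ℝ) (hδ0 : 0 < δ) (hδ1 : δ < 1) :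
    Integrable F (gumbelProduct m) ∧
    1 - δ ≤ P.real {ω | (1 / (M : ℝ)) * (∑ j, η j ω) - (∫ y, F y ∂(gumbelProduct m)) ≤
      max (20 * b / M * Real.log (1 / δ)) (Real.sqrt (20 * a ^ 2 / M * Real.log (1 / δ)))} := by
  -- Only `a ^ 2` enters, while the mixed Lipschitz bound needs a nonnegative constant.
  rw [← sq_abs a] at hF_grad ⊢
  have hF := mixedLipschitz_of_ae_gradient hF_cont hF_ac (abs_nonneg a)
    ((volume_absolutelyContinuous_gumbelProduct m).ae_le hF_grad)
  by_cases hab : 0 < |a| ∧ 0 < b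
  · exact ⟨hF.integrable hF_cont hab.2, hF.measureReal_deviation_le hF_cont hab.1 hab.2 P hM η
      hη_indep hη_law δ hδ0 hδ1⟩
  -- In the degenerate case `a = 0` or `b ≤ 0` the increments vanish and `F` is constant.
  have hle : ∀ x y, F x ≤ F y := fun x y => by
    rw [← sub_nonpos]
    rcases not_and_or.1 hab with h | h
    · simpa [le_antisymm (not_lt.1 h) (abs_nonneg a)] using hF Finset.univ x y
    · exact (hF.sub_le x y).trans (mul_nonpos_of_nonpos_of_nonneg (not_lt.1 h)
        (Finset.sum_nonneg fun i _ => abs_nonneg _))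
  obtain ⟨k, rfl⟩ : ∃ k : ℝ, F = fun _ => k := ⟨F 0, funext fun x => (hle x 0).antisymm (hle 0 x)⟩
  refine ⟨integrable_const k, ?_⟩
  have hη : ∀ᵐ ω ∂P, ∀ j, η j ω = k := ae_all_iff.2 fun j =>
    (hη_law j).symm.ae_snd (p := fun x => x = k) (measurableSet_singleton k)
      (ae_of_all _ fun _ => rfl)
  have hM0 : (M : ℝ) ≠ 0 := by
    have : (1 : ℝ) ≤ M := by exact_mod_cast hM
    linarith
  refine (sub_le_self 1 hδ0.le).trans_eq (Eq.symm ?_)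
  rw [← probReal_univ (μ := P)]
  refine measureReal_congr (eventuallyEq_univ.2 ?_)
  filter_upwards [hη] with ω hω
  simp only [hω]
  -- The deviation is 0, and the maximum is nonnegative because of the square root, whatever the
  -- sign of `b`.
  simp [hM0]
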